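/- Let $G=(V,E)$ be a finite, simple, connected, undirected graph with $n=|V|$. A set $U\subseteq V$ is a *cut* if $G-U$ is disconnected; the *sides* of $U$ are the vertex sets of the connected components of $G-U$. Let $\kappa=\kappa(G)$ be the least size of a cut and assume $\kappa<n/4$. A *$\kappa$-cut* is a cut of size $\kappa$. A cut $W$ *separates* $C$ from $D$ if $C\cap W=D\cap W=\emptyset$ and no side of $W$ meets both $C$ and $D$. *Definitions.* - A cut $U$ is *$(\mathrm I,t)$-small* if it has a side such that the sizes of all its other sides add up to at most $t$. - A *wheel* is a partition of $V$ into sets $T, C_1,\dots,C_w, S_1,\dots,S_w$ ($w\ge 4$, indices modulo $w$; the $C_i$ and $S_i$ nonempty, $T$ possibly empty) such that, for every $i$, $C_i\cup T\cup C_{i+2}$ is a $\kappa$-cut that separates $S_i\cup C_{i+1}\cup S_{i+1}$ from the remaining vertices. Its *wheel cuts* are the sets $C_i\cup T\cup C_j$, $i\ne j$. - For a $\kappa$-cut $U$ and a side $P$ of $U$, a $\kappa$-cut $W\neq U$ with $W\subseteq U\cup P$ is *laminar with respect to $U$ in the side $P$*. - Let $U$ be a $\kappa$-cut, $A$ a side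 of $U$, and $\emptyset\ne P\subseteq U$. A $\kappa$-cut $W$ is a *matching cut of $U$ in side $A$ with respect to $P$* if $U\setminus P\subseteq W\subseteq U\cup A$, $A\setminus W\neq\emptyset$, and $W$ separates $P\cup (V\setminus(U\cup A))$ from $A\setminus W$; then $\mathrm{Mat}(P):=W\setminus U$. - If $U$ has exactly two sides $A,B$ and $\emptyset\ne P\subseteq U$, a $\kappa$-cut $W$ is a *crossing matching cut of $U$ in side $A$ with respect to $P$* if $W\cap B\ne\emptyset$ and $(U\setminus P)\cup(W\cap A)$ is a matching cut of $U$ in side $A$ with respect to $P$. *Setting.* Let $U$ be a $\kappa$-cut that is not $(\mathrm I,\kappa-1)$-small and is not a wheel cut of any wheel, and let $A$ be a side of $U$ with $|A|>2\kappa$. From now on, a *laminar cut (of $U$ in side $A$)* is a $\kappa$-cut $W\ne U$ with $W\subseteq U\cup A$ that is not $(\mathrm I,\kappa-1)$-small. Such a $W$ has a unique side $S(W)$ that contains $U\setminus W$ and all sides of $U$ other than $A$; let $R(W)$ be the union of all other sides of $W$. A laminar cut $W$ is *maximal* if there is no laminar cut $W'\ne W$ with $R(W)\subseteq R(W')$.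 Let $\Theta$ be the family of all $P$ such that $U$ has a matching cut in side $A$ with respect to $P$, let $\Theta^*$ be the family of the sets $\bigcap\{P\in\Theta : u\in P\}$ for those $u\in U$ that lie in some $P\in\Theta$, and let $Q=\bigcup_{P\in\Theta^*}P$. **Theorem.** 1. Suppose that $U$ has a matching cut in side $A$. Then there is a matching cut $X=(U\setminus Q)\cup \mathrm{Mat}(Q)$ of $U$ in side $A$ with respect to $Q$, and $X\cap U\subsetneq Y\cap U$ for every other matching cut $Y$ of $U$ in side $A$. Every laminar cut $W$ of $U$ in side $A$ is (i) laminar with respect to $X$ in a side of $X$ contained in $A\setminus \mathrm{Mat}(Q)$, or (ii) a matching cut of $U$ in side $A$ with respect to some $P$, or (iii) a crossing matching cut of $X$ (in some side of $X$, with respect to some nonempty subset of $X$). 2. Suppose that $U$ has no matching cut in side $A$. Then every laminar cut $W$ of $U$ in side $A$ is maximal, or there is a maximal laminar cut $W'$ such that $W$ is laminar with respect to $W'$ in a side of $W'$ contained in $R(W')$. Moreover, $R(W_1)\cap R(W_2)=\emptyset$ for all distinct maximal laminar cuts $W_1,W_2$. -/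

import Mathlib

namespace VertexCuts

variable {V : Type*}

/-- `U` is a (vertex) cut of `G`: the graph induced on the complement of `U` is disconnected. -/
def IsCut (G : SimpleGraph V) (U : Set V) : Prop :=
  ¬ (G.induce Uᶜ).Preconnected

/-- `A` is a side of `U`: the vertex set of a connected component of `G` minus `U`. -/
def IsSide (G : SimpleGraph V) (U A : Set V) : Prop :=
  ∃ c : (G.induce Uᶜ).ConnectedComponent, A = Subtype.val '' c.supp

/-- The vertex connectivity `κ(G)`: the least size of a cut, equivalently the minimum over
non-adjacent pairs `u ≠ v` of the least size of a cut separating `u` from `v`. -/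
noncomputable def kappa (G : SimpleGraph V) : ℕ :=
  sInf {k : ℕ | ∃ U : Set V, IsCut G U ∧ U.ncard = k}

/-- `U` is a (minimum) `κ`-cut. -/
def IsKCut (G : SimpleGraph V) (U : Set V) : Prop :=
  IsCut G U ∧ U.ncard = kappa G

/-- The cut `W` separates `C` from `D`: both avoid `W`, and no side of `W` meets both. -/
def Separates (G : SimpleGraph V) (W C D : Set V) : Prop :=
  Disjoint C W ∧ Disjoint D W ∧
    ∀ S : Set V, IsSide G W S → ¬ ((S ∩ C).Nonempty ∧ (S ∩ D).Nonempty)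

/-- `U` is `(I, t)`-small: for some (large) side `A` of `U`, the sizes of the other sides of `U`
sum up to at most `t`. The other sides partition `(U ∪ A)ᶜ`. -/
def IsSmallI (G : SimpleGraph V) (U : Set V) (t : ℕ) : Prop :=
  ∃ A : Set V, IsSide G U A ∧ ((U ∪ A)ᶜ).ncard ≤ t

/-- `W` is a (minimum) cut, other than `U`, that is laminar with respect to `U` in the
side `P` of `U`. -/
def IsLaminarIn (G : SimpleGraph V) (U P W : Set V) : Prop :=
  IsSide G U P ∧ IsKCut G W ∧ W ≠ U ∧ W ⊆ U ∪ P

/-- `(T; C₁, …, C_w)` is a `w`-wheel of minimum cuts with sectors `S₁, …, S_w`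
(indices modulo `w`). -/
structure IsWheel (G : SimpleGraph V) (w : ℕ) (T : Set V) (C S : ZMod w → Set V) : Prop where
  four_le : 4 ≤ w
  spoke_nonempty : ∀ i, (C i).Nonempty
  sector_nonempty : ∀ i, (S i).Nonempty
  spoke_disjoint : ∀ i j, i ≠ j → Disjoint (C i) (C j)
  sector_disjoint : ∀ i j, i ≠ j → Disjoint (S i) (S j)
  spoke_disjoint_sector : ∀ i j, Disjoint (C i) (S j)
  center_disjoint_spoke : ∀ i, Disjoint T (C i)
  center_disjoint_sector : ∀ i, Disjoint T (S i)
  cover : T ∪ (⋃ i, C i) ∪ (⋃ i, S i) = Set.univ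
  kcut : ∀ i, IsKCut G (C i ∪ T ∪ C (i + 2))
  separates : ∀ i, Separates G (C i ∪ T ∪ C (i + 2)) (S i ∪ C (i + 1) ∪ S (i + 1))
    ((C i ∪ T ∪ C (i + 2)) ∪ (S i ∪ C (i + 1) ∪ S (i + 1)))ᶜ

/-- `U` is one of the cuts `C(i, j) = C_i ∪ T ∪ C_j`, `i ≠ j`, of some wheel. -/
def IsWheelCut (G : SimpleGraph V) (U : Set V) : Prop :=
  ∃ (w : ℕ) (T : Set V) (C S : ZMod w → Set V) (i j : ZMod w),
    IsWheel G w T C S ∧ i ≠ j ∧ U = C i ∪ T ∪ C j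

/-- `W` is a matching cut of `U` in side `A` with respect to the nonempty set `P ⊆ U`. -/
def IsMatchingCut (G : SimpleGraph V) (U A P W : Set V) : Prop :=
  IsSide G U A ∧ P ⊆ U ∧ P.Nonempty ∧ IsKCut G W ∧
    U \ P ⊆ W ∧ W ⊆ U ∪ A ∧ (A \ W).Nonempty ∧
    Separates G W (P ∪ (U ∪ A)ᶜ) (A \ W)

/-- `W` is a crossing matching cut of `U` in side `A` with respect to the nonempty set `P ⊆ U`,
where `U` has exactly two sides, `A` and `B`. -/
def IsCrossingMatchingCut (G : SimpleGraph V) (U A P W : Set V) : Prop :=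
  IsKCut G W ∧ ∃ B : Set V, A ≠ B ∧ (∀ D : Set V, IsSide G U D ↔ D = A ∨ D = B) ∧
    P ⊆ U ∧ P.Nonempty ∧ (W ∩ B).Nonempty ∧
    IsMatchingCut G U A P ((U \ P) ∪ (W ∩ A))

/-- `Θ`: the sets `P` with respect to which `U` has a matching cut in side `A`. -/
def Theta (G : SimpleGraph V) (U A : Set V) : Set (Set V) :=
  {P | ∃ W : Set V, IsMatchingCut G U A P W}

/-- `Θ*`: the sets `⋂ {P ∈ Θ | u ∈ P}`, for the vertices `u ∈ U` that lie in some `P ∈ Θ`. -/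
def ThetaStar (G : SimpleGraph V) (U A : Set V) : Set (Set V) :=
  {R | ∃ u ∈ U, (∃ P ∈ Theta G U A, u ∈ P) ∧ R = ⋂₀ {P | P ∈ Theta G U A ∧ u ∈ P}}

/-- The laminar cuts of the reference cut `U` in side `A` under consideration: those that are
not `(I, κ - 1)`-small. -/
def IsLaminarCut (G : SimpleGraph V) (U A W : Set V) : Prop :=
  IsLaminarIn G U A W ∧ ¬ IsSmallI G W (kappa G - 1)

/-- `S` is the side `S(W)` of the laminar cut `W` of `U` in side `A`: the side of `W` that
contains `U \ W` and all sides of `U` other than `A`. -/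
def IsOuterSide (G : SimpleGraph V) (U A W S : Set V) : Prop :=
  IsSide G W S ∧ U \ W ⊆ S ∧ ∀ D : Set V, IsSide G U D → D ≠ A → D ⊆ S

/-- The region `R(W)`: the union of all sides of `W` other than `S(W)`. -/
def region (G : SimpleGraph V) (U A W : Set V) : Set V :=
  ⋃₀ {D | IsSide G W D ∧ ¬ IsOuterSide G U A W D}

/-- `W` is a maximal laminar cut of `U` in side `A`. -/
def IsMaximalLaminarCut (G : SimpleGraph V) (U A W : Set V) : Prop :=
  IsLaminarCut G U A W ∧
    ¬ ∃ W' : Set V, IsLaminarCut G U A W' ∧ W' ≠ W ∧ region G U A W ⊆ region G U A W'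

/-! The side `S(W)` exists and is unique. -/

theorem reach_mem {G : SimpleGraph V} {W C : Set V}
    (h : ∀ c ∈ C, ∀ x, x ∉ W → G.Adj c x → x ∈ C) {a b : ↥(Wᶜ)}
    (hab : (G.induce Wᶜ).Reachable a b) (ha : (a : V) ∈ C) : (b : V) ∈ C := by
  obtain ⟨p⟩ := hab
  induction p with
  | nil => exact ha
  | cons hadj _ ih => exact ih (h _ ha _ (Set.mem_compl_iff _ _ |>.1 (Subtype.prop _)) hadj)

theorem IsSide.nonempty {G : SimpleGraph V} {U A : Set V} (h : IsSide G U A) : A.Nonempty := by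
  obtain ⟨c, rfl⟩ := h
  exact c.nonempty_supp.image _

theorem IsSide.disjoint {G : SimpleGraph V} {U A : Set V} (h : IsSide G U A) :
    ∀ x ∈ A, x ∉ U := by
  obtain ⟨c, rfl⟩ := h
  rintro _ ⟨y, _, rfl⟩
  exact y.2

theorem IsSide.closed {G : SimpleGraph V} {U A : Set V} (h : IsSide G U A) :
    ∀ c ∈ A, ∀ x, x ∉ U → G.Adj c x → x ∈ A := by
  obtain ⟨c, rfl⟩ := h
  rintro _ ⟨y, hy, rfl⟩ x hx hadj
  refine ⟨⟨x, hx⟩, ?_, rfl⟩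
  have : (G.induce Uᶜ).Adj y ⟨x, hx⟩ := hadj
  rw [SimpleGraph.ConnectedComponent.mem_supp_iff] at hy ⊢
  rw [← hy]
  exact SimpleGraph.ConnectedComponent.eq.2 this.symm.reachable

/-- A side of `U` that contains no vertex of `W` lies in any set that it meets and that is closed
under adjacency outside `W`. -/
theorem IsSide.subset_of_closed {G : SimpleGraph V} {U A W C : Set V} (h : IsSide G U A)
    (hW : Disjoint A W) (hC : ∀ c ∈ C, ∀ x, x ∉ W → G.Adj c x → x ∈ C)
    (hm : (A ∩ C).Nonempty) : A ⊆ C := by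
  intro x hx
  obtain ⟨a, haA, haC⟩ := hm
  have hcl : ∀ c ∈ {y | y ∈ A ∧ y ∈ C}, ∀ y, y ∉ U → G.Adj c y → y ∈ {y | y ∈ A ∧ y ∈ C} := by
    rintro c ⟨h1, h2⟩ y hy hadj
    have hyA := h.closed c h1 y hy hadj
    exact ⟨hyA, hC c h2 y (Set.disjoint_left.1 hW hyA) hadj⟩
  have hr : (G.induce Uᶜ).Reachable ⟨a, h.disjoint a haA⟩ ⟨x, h.disjoint x hx⟩ := by
    obtain ⟨c, rfl⟩ := h
    obtain ⟨a', ha', rfl⟩ := haA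
    obtain ⟨x', hx', rfl⟩ := hx
    exact SimpleGraph.ConnectedComponent.eq.1 (ha'.trans hx'.symm)
  exact (reach_mem (C := {y | y ∈ A ∧ y ∈ C}) hcl hr ⟨haA, haC⟩).2

theorem exists_side {G : SimpleGraph V} {U : Set V} {x : V} (hx : x ∉ U) :
    ∃ A, IsSide G U A ∧ x ∈ A :=
  ⟨_, ⟨(G.induce Uᶜ).connectedComponentMk ⟨x, hx⟩, rfl⟩, ⟨x, hx⟩, rfl, rfl⟩

theorem IsSide.eq_of_inter {G : SimpleGraph V} {U A B : Set V} (hA : IsSide G U A)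
    (hB : IsSide G U B) (h : (A ∩ B).Nonempty) : A = B :=
  Set.Subset.antisymm
    (hA.subset_of_closed (Set.disjoint_left.2 hA.disjoint) hB.closed h)
    (hB.subset_of_closed (Set.disjoint_left.2 hB.disjoint) hA.closed (by rwa [Set.inter_comm]))

theorem IsCut.exists_other_side {G : SimpleGraph V} {U : Set V} (h : IsCut G U) (A : Set V) :
    ∃ B, IsSide G U B ∧ B ≠ A := by
  by_contra hcon
  push Not at hcon
  refine h fun x y => ?_
  have hx := hcon _ ⟨(G.induce Uᶜ).connectedComponentMk x, rfl⟩
  have hy := hcon _ ⟨(G.induce Uᶜ).connectedComponentMk y, rfl⟩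
  have := Subtype.val_injective.image_injective (hx.trans hy.symm)
  exact SimpleGraph.ConnectedComponent.eq.1 (SimpleGraph.ConnectedComponent.supp_injective this)

/-- Every vertex of a minimum cut has a neighbor in every side. -/
theorem IsKCut.exists_adj [Finite V] {G : SimpleGraph V} {U D : Set V} (hU : IsKCut G U)
    (hD : IsSide G U D) {u : V} (hu : u ∈ U) : ∃ d ∈ D, G.Adj d u := by
  by_contra hcon
  push Not at hcon
  have hcut : IsCut G (U \ {u}) := by
    intro hpre
    obtain ⟨d, hd⟩ := hD.nonempty
    have hd' : d ∉ U \ {u} := fun h => hD.disjoint d hd h.1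
    have hu' : u ∉ U \ {u} := fun h => h.2 rfl
    have hcl : ∀ c ∈ D, ∀ x, x ∉ U \ {u} → G.Adj c x → x ∈ D := by
      intro c hc x hx hadj
      by_cases hxu : x = u
      · subst hxu
        exact absurd hadj (hcon c hc)
      · exact hD.closed c hc x (fun h => hx ⟨h, hxu⟩) hadj
    exact hD.disjoint u (reach_mem hcl (hpre ⟨d, hd'⟩ ⟨u, hu'⟩) hd) hu
  have h1 : kappa G ≤ (U \ {u}).ncard := Nat.sInf_le ⟨_, hcut, rfl⟩
  have h2 := Set.ncard_sdiff_singleton_lt_of_mem hu (Set.toFinite U)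
  have h3 := hU.2
  omega

theorem existsUnique_outerSide [Finite V] {G : SimpleGraph V} {U A W : Set V} (hU : IsKCut G U)
    (hW : IsLaminarIn G U A W) : ∃! S, IsOuterSide G U A W S := by
  obtain ⟨hA, hWk, hne, hsub⟩ := hW
  have hex : ∃ u ∈ U, u ∉ W := by
    by_contra hcon
    push Not at hcon
    exact hne (Set.eq_of_subset_of_ncard_le hcon (by rw [hU.2, hWk.2])).symm
  obtain ⟨u, huU, huW⟩ := hex
  obtain ⟨S, hS, huS⟩ := exists_side (G := G) huW
  have hdisj : ∀ D, IsSide G U D → D ≠ A → Disjoint D W := by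
    intro D hD hDA
    refine Set.disjoint_left.2 fun x hx hxW => ?_
    rcases hsub hxW with h | h
    · exact hD.disjoint x hx h
    · exact hDA (hD.eq_of_inter hA ⟨x, hx, h⟩)
  have hsides : ∀ D, IsSide G U D → D ≠ A → D ⊆ S := by
    intro D hD hDA
    have hDW := hdisj D hD hDA
    obtain ⟨d, hd, hadj⟩ := hU.exists_adj hD huU
    exact hD.subset_of_closed hDW hS.closed
      ⟨d, hd, hS.closed u huS d (Set.disjoint_left.1 hDW hd) hadj.symm⟩
  refine ⟨S, ⟨hS, ?_, hsides⟩, ?_⟩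
  · rintro x ⟨hxU, hxW⟩
    obtain ⟨D, hD, hDA⟩ := hU.1.exists_other_side A
    obtain ⟨d, hd, hadj⟩ := hU.exists_adj hD hxU
    exact hS.closed d (hsides D hD hDA hd) x hxW hadj
  · rintro S' ⟨hS', hsub', -⟩
    exact hS'.eq_of_inter hS ⟨u, hsub' ⟨huU, huW⟩, huS⟩

end VertexCuts

open VertexCuts

namespace VertexCuts

variable {V : Type*}

/-! Everything rests on uncrossing. Let two minimum cuts have parts `C`, `D` and `C'`, `D'`. The
boundaries of the opposite corners `C ∩ C'` and `D ∩ D'` have total size `2κ`; if both corners are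
nonempty, both boundaries are cuts, hence minimum cuts (`IsSplit.uncross`).

With a matching cut: since `|A| > 2κ`, two matching cuts leave a common vertex of `A`, so `Θ` is
closed under union and its largest member is `Q` (`IsMatchingCut.union`). Any matching cut `X` with
respect to `P` has `Z = P ∪ (U ∪ A)ᶜ` as a side, and `R(W)` avoids `Z`. Whether a laminar cut `W`
meets `Z`, and whether it meets `A \ X`, decides between the three outcomes
(`IsLaminarCut.trichotomy`); in the crossing case non-smallness of `W` makes the needed corners
nonempty.

Without one: if the regions of two maximal laminar cuts meet, uncrossing gives a minimum cut
enclosing both regions. If it differs from `U`, it is a laminar cut and contradicts maximality. If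
it equals `U`, the absence of matching cuts makes all four corners nonempty, so `U` is a wheel cut
of a 4-wheel (`isWheelCut_corner`). -/

/-- `W` is a minimum cut, and `C`, `D` partition the remaining vertices into two nonempty sets
without edges between them. -/
structure IsSplit (G : SimpleGraph V) (W C D : Set V) : Prop where
  kcut : IsKCut G W
  left_nonempty : C.Nonempty
  right_nonempty : D.Nonempty
  left_disjoint : ∀ x ∈ C, x ∉ W
  right_disjoint : ∀ x ∈ D, x ∉ W
  disjoint : ∀ x ∈ C, x ∉ D
  cover : ∀ x, x ∉ W → x ∉ C → x ∈ D
  not_adj : ∀ c ∈ C, ∀ d ∈ D, ¬ G.Adj c d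

variable {G : SimpleGraph V} {U A W X C D C' D' S P : Set V}

/-! ### Minimum cuts and splits -/

theorem isCut_of_closed (h : ∀ c ∈ C, ∀ x, x ∉ W → G.Adj c x → x ∈ C) {a b : V}
    (ha : a ∈ C) (haW : a ∉ W) (hb : b ∉ C) (hbW : b ∉ W) : IsCut G W := fun hpre =>
  hb (reach_mem h (hpre ⟨a, haW⟩ ⟨b, hbW⟩) ha)

theorem kappa_le (h : IsCut G W) : kappa G ≤ W.ncard := Nat.sInf_le ⟨_, h, rfl⟩

theorem IsKCut.eq_of_subset [Finite V] (hW : IsKCut G W) (hX : IsKCut G X) (h : W ⊆ X) : W = X :=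
  Set.eq_of_subset_of_ncard_le h (by rw [hW.2, hX.2])

theorem IsKCut.exists_mem_notMem [Finite V] (hW : IsKCut G W) (hX : IsKCut G X) (h : W ≠ X) :
    ∃ x ∈ X, x ∉ W := by
  by_contra hcon
  push Not at hcon
  exact h (hX.eq_of_subset hW hcon).symm

/-- A side meeting a set that is closed under adjacency outside the cut lies in it. -/
theorem IsSide.subset_closed (hS : IsSide G W S)
    (h : ∀ c ∈ C, ∀ x, x ∉ W → G.Adj c x → x ∈ C) {x : V} (hx : x ∈ S) (hxC : x ∈ C) : S ⊆ C :=
  hS.subset_of_closed (Set.disjoint_left.2 hS.disjoint) h ⟨x, hx, hxC⟩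

theorem IsSplit.symm (h : IsSplit G W C D) : IsSplit G W D C where
  kcut := h.kcut
  left_nonempty := h.right_nonempty
  right_nonempty := h.left_nonempty
  left_disjoint := h.right_disjoint
  right_disjoint := h.left_disjoint
  disjoint x hx hxC := h.disjoint x hxC hx
  cover x hx hxD := by
    by_contra hxC
    exact hxD (h.cover x hx hxC)
  not_adj c hc d hd hadj := h.not_adj d hd c hc hadj.symm

theorem IsSplit.closed (h : IsSplit G W C D) : ∀ c ∈ C, ∀ x, x ∉ W → G.Adj c x → x ∈ C := by
  intro c hc x hx hadj
  by_contra hxC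
  exact h.not_adj c hc x (h.cover x hx hxC) hadj

theorem IsSplit.side_subset (h : IsSplit G W C D) (hS : IsSide G W S) {x : V} (hx : x ∈ S)
    (hxC : x ∈ C) : S ⊆ C :=
  hS.subset_closed h.closed hx hxC

theorem IsSplit.exists_side (h : IsSplit G W C D) : ∃ S, IsSide G W S ∧ S ⊆ C := by
  obtain ⟨c, hc⟩ := h.left_nonempty
  obtain ⟨S, hS, hcS⟩ := VertexCuts.exists_side (G := G) (h.left_disjoint c hc)
  exact ⟨S, hS, h.side_subset hS hcS hc⟩

theorem IsSplit.exists_adj [Finite V] (h : IsSplit G W C D) {w : V} (hw : w ∈ W) :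
    ∃ c ∈ C, G.Adj c w := by
  obtain ⟨S, hS, hSC⟩ := h.exists_side
  obtain ⟨c, hc, hadj⟩ := h.kcut.exists_adj hS hw
  exact ⟨c, hSC hc, hadj⟩

/-- The cut of a split is contained in any cut that closes off the same vertices. -/
theorem IsSplit.cut_subset [Finite V] (h : IsSplit G W C D) (h' : IsSplit G X C' D')
    (hC : C ⊆ C') : W ⊆ X ∪ C' := by
  intro w hw
  obtain ⟨c, hc, hadj⟩ := h.exists_adj hw
  by_cases hX : w ∈ X
  · exact Or.inl hX
  · exact Or.inr (h'.closed c (hC hc) w hX hadj)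

theorem IsSplit.separates (h : IsSplit G W C D) : Separates G W C D := by
  refine ⟨Set.disjoint_left.2 h.left_disjoint, Set.disjoint_left.2 h.right_disjoint, ?_⟩
  rintro S hS ⟨⟨x, hxS, hxC⟩, ⟨y, hyS, hyD⟩⟩
  exact h.disjoint y (h.side_subset hS hxS hxC hyS) hyD

theorem IsSplit.compl_eq (h : IsSplit G W C D) : (W ∪ C)ᶜ = D := by
  ext x
  have h1 := h.cover x
  have h2 := h.right_disjoint x
  have h3 := h.disjoint x
  simp only [Set.mem_compl_iff, Set.mem_union]
  tauto

theorem IsKCut.split_of_side (hW : IsKCut G W) (hS : IsSide G W S) :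
    IsSplit G W S (W ∪ S)ᶜ where
  kcut := hW
  left_nonempty := hS.nonempty
  right_nonempty := by
    obtain ⟨T, hT, hTS⟩ := hW.1.exists_other_side S
    obtain ⟨t, ht⟩ := hT.nonempty
    refine ⟨t, ?_⟩
    rintro (h | h)
    · exact hT.disjoint t ht h
    · exact hTS (hT.eq_of_inter hS ⟨t, ht, h⟩)
  left_disjoint := hS.disjoint
  right_disjoint x hx hxW := hx (Or.inl hxW)
  disjoint x hx hxD := hxD (Or.inr hx)
  cover x hx hxS := fun h => h.elim hx hxS
  not_adj c hc d hd hadj := hd (Or.inr (hS.closed c hc d (fun h => hd (Or.inl h)) hadj))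

theorem IsKCut.split_of_separates (hW : IsKCut G W) (h : Separates G W C D) (hC : C.Nonempty)
    (hD : D.Nonempty) (hcov : ∀ x, x ∉ W → x ∉ C → x ∈ D) : IsSplit G W C D where
  kcut := hW
  left_nonempty := hC
  right_nonempty := hD
  left_disjoint := Set.disjoint_left.1 h.1
  right_disjoint := Set.disjoint_left.1 h.2.1
  disjoint x hx hxD := by
    obtain ⟨S, hS, hxS⟩ := exists_side (G := G) (Set.disjoint_left.1 h.1 hx)
    exact h.2.2 S hS ⟨⟨x, hxS, hx⟩, ⟨x, hxS, hxD⟩⟩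
  cover := hcov
  not_adj c hc d hd hadj := by
    obtain ⟨S, hS, hcS⟩ := exists_side (G := G) (Set.disjoint_left.1 h.1 hc)
    exact h.2.2 S hS ⟨⟨c, hcS, hc⟩,
      ⟨d, hS.closed c hcS d (Set.disjoint_left.1 h.2.1 hd) hadj, hd⟩⟩

/-! ### Corners and uncrossing -/

/-- The vertices of `W ∪ X` bounding `C ∩ C'`. -/
def corner (W C X C' : Set V) : Set V := (W ∩ C') ∪ (W ∩ X) ∪ (X ∩ C)

theorem corner_isCut (hC : ∀ c ∈ C, ∀ x, x ∉ W → G.Adj c x → x ∈ C)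
    (hC' : ∀ c ∈ C', ∀ x, x ∉ X → G.Adj c x → x ∈ C') {a b : V} (ha : a ∈ C ∩ C')
    (haW : a ∉ W) (haX : a ∉ X) (hb : b ∉ C ∩ C') (hbW : b ∉ corner W C X C') :
    IsCut G (corner W C X C') := by
  refine isCut_of_closed (C := C ∩ C') ?_ ha ?_ hb hbW
  · rintro c ⟨hc, hc'⟩ x hx hadj
    have h1 := hC c hc x
    have h2 := hC' c hc' x
    simp only [corner, Set.mem_union, Set.mem_inter_iff] at hx ⊢
    tauto
  · simp only [corner, Set.mem_union, Set.mem_inter_iff]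
    tauto

/-- Opposite corner boundaries have union `W ∪ X` and intersection `W ∩ X`. -/
theorem corner_ncard_add [Finite V] (h : IsSplit G W C D) (h' : IsSplit G X C' D') :
    (corner W C X C').ncard + (corner W D X D').ncard = W.ncard + X.ncard := by
  have hi : corner W C X C' ∩ corner W D X D' = W ∩ X := by
    ext x
    have h1 := h.left_disjoint x
    have h2 := h.right_disjoint x
    have h3 := h.disjoint x
    have h4 := h'.left_disjoint x
    have h5 := h'.right_disjoint x
    have h6 := h'.disjoint x
    simp only [corner, Set.mem_union, Set.mem_inter_iff]
    tauto
  have hu : corner W C X C' ∪ corner W D X D' = W ∪ X := by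
    ext x
    have h1 := h.cover x
    have h4 := h'.cover x
    simp only [corner, Set.mem_union, Set.mem_inter_iff]
    tauto
  rw [← Set.ncard_union_add_ncard_inter, hi, hu, Set.ncard_union_add_ncard_inter]

/-- Uncrossing: opposite corners of two crossing minimum cuts are bounded by minimum cuts. -/
theorem IsSplit.uncross [Finite V] (h : IsSplit G W C D) (h' : IsSplit G X C' D')
    (hC : (C ∩ C').Nonempty) (hD : (D ∩ D').Nonempty) :
    IsSplit G (corner W C X C') (C ∩ C') (D ∪ D') := by
  obtain ⟨a, ha, ha'⟩ := hC
  obtain ⟨b, hb, hb'⟩ := hD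
  have mem_corner : ∀ {C C' : Set V} {x : V}, x ∉ W → x ∉ X → x ∉ corner W C X C' := by
    intro C C' x hW hX
    simp only [corner, Set.mem_union, Set.mem_inter_iff]
    tauto
  have haW := h.left_disjoint a ha
  have haX := h'.left_disjoint a ha'
  have hbW := h.right_disjoint b hb
  have hbX := h'.right_disjoint b hb'
  have haD := h.disjoint a ha
  have hbC := h.symm.disjoint b hb
  have c1 : IsCut G (corner W C X C') :=
    corner_isCut h.closed h'.closed ⟨ha, ha'⟩ haW haX (fun hh => hbC hh.1) (mem_corner hbW hbX)
  have c2 : IsCut G (corner W D X D') :=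
    corner_isCut h.symm.closed h'.symm.closed ⟨hb, hb'⟩ hbW hbX (fun hh => haD hh.1)
      (mem_corner haW haX)
  -- The sizes add up to `2κ` and neither is below `κ`, so both equal `κ`.
  have hsum := corner_ncard_add h h'
  have k1 := kappa_le c1
  have k2 := kappa_le c2
  have k3 := h.kcut.2
  have k4 := h'.kcut.2
  refine ⟨⟨c1, by omega⟩, ⟨a, ha, ha'⟩, ⟨b, Or.inl hb⟩, ?_, ?_, ?_, ?_, ?_⟩
  · rintro x ⟨hx, hx'⟩
    exact mem_corner (h.left_disjoint x hx) (h'.left_disjoint x hx')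
  · intro x
    have h1 := h.right_disjoint x
    have h2 := h'.right_disjoint x
    have h3 := h.disjoint x
    have h4 := h'.disjoint x
    simp only [corner, Set.mem_union, Set.mem_inter_iff]
    tauto
  · rintro x ⟨hx, hx'⟩ (hd | hd)
    · exact h.disjoint x hx hd
    · exact h'.disjoint x hx' hd
  · intro x
    have h1 := h.cover x
    have h2 := h'.cover x
    simp only [corner, Set.mem_union, Set.mem_inter_iff]
    tauto
  · rintro c ⟨hc, hc'⟩ d (hd | hd)
    · exact h.not_adj c hc d hd
    · exact h'.not_adj c hc' d hd

/-! ### Relative position of two minimum cuts -/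

/-- A minimum cut that misses a side of another one is laminar with respect to it. -/
theorem exists_isLaminarIn [Finite V] (hX : IsKCut G X) (hW : IsKCut G W) (hne : W ≠ X)
    (hD : IsSide G X D) (hDW : Disjoint D W) : ∃ L, L ≠ D ∧ IsLaminarIn G X L W := by
  obtain ⟨x, hxX, hxW⟩ := hW.exists_mem_notMem hX hne
  obtain ⟨S, hS, hxS⟩ := exists_side (G := G) hxW
  have hDS : D ⊆ S := by
    obtain ⟨d, hd, hadj⟩ := hX.exists_adj hD hxX
    exact hD.subset_of_closed hDW hS.closed
      ⟨d, hd, hS.closed x hxS d (Set.disjoint_left.1 hDW hd) hadj.symm⟩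
  -- All of `X \ W` is attached to `D`, hence lies in `S`. Another side `T` of `W` therefore avoids
  -- `X` and fits into one side `L` of `X`; every vertex of `W` has a neighbor in `T`, which
  -- confines `W` to `X ∪ L`.
  obtain ⟨T, hT, hTS⟩ := hW.1.exists_other_side S
  have hdis : ∀ t ∈ T, t ∉ S := fun t ht hs => hTS (hT.eq_of_inter hS ⟨t, ht, hs⟩)
  have hTX : Disjoint T X := by
    refine Set.disjoint_left.2 fun t ht htX => hdis t ht ?_
    obtain ⟨d, hd, hadj⟩ := hX.exists_adj hD htX
    exact hS.closed d (hDS hd) t (hT.disjoint t ht) hadj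
  obtain ⟨t, ht⟩ := hT.nonempty
  obtain ⟨L, hL, htL⟩ := exists_side (G := G) (Set.disjoint_left.1 hTX ht)
  have hTL : T ⊆ L := hT.subset_of_closed hTX hL.closed ⟨t, ht, htL⟩
  refine ⟨L, ?_, hL, hW, hne, ?_⟩
  · rintro rfl
    exact hdis t ht (hDS htL)
  · intro w hw
    obtain ⟨c, hc, hadj⟩ := hW.exists_adj hT hw
    by_cases hwX : w ∈ X
    · exact Or.inl hwX
    · exact Or.inr (hL.closed c (hTL hc) w hwX hadj)

/-- A minimum cut meeting both parts of a split leaves no side that misses the split cut. -/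
theorem IsSplit.side_inter_nonempty [Finite V] (h : IsSplit G X C D) (hW : IsKCut G W)
    (hC : (W ∩ C).Nonempty) (hD : (W ∩ D).Nonempty) (hS : IsSide G W S) : (S ∩ X).Nonempty := by
  by_contra hcon
  have hSX : Disjoint S X := Set.disjoint_iff_inter_eq_empty.2 (Set.not_nonempty_iff_eq_empty.1 hcon)
  have key : ∀ {C D : Set V}, IsSplit G X C D → (W ∩ C).Nonempty → S ⊆ C := by
    rintro C D h ⟨w, hw, hwC⟩
    obtain ⟨s, hs, hadj⟩ := hW.exists_adj hS hw
    exact hS.subset_of_closed hSX h.closed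
      ⟨s, hs, h.closed w hwC s (Set.disjoint_left.1 hSX hs) hadj.symm⟩
  obtain ⟨s, hs⟩ := hS.nonempty
  exact h.disjoint s (key h hC hs) (key h.symm hD hs)

/-! ### Matching cuts -/

theorem IsMatchingCut.split (h : IsMatchingCut G U A P W) :
    IsSplit G W (P ∪ (U ∪ A)ᶜ) (A \ W) := by
  obtain ⟨hA, hPU, hP, hW, hUW, hWU, hne, hsep⟩ := h
  refine hW.split_of_separates hsep (hP.mono Set.subset_union_left) hne fun x hxW hx => ?_
  have h1 := @hUW x
  simp only [Set.mem_union, Set.mem_compl_iff, Set.mem_sdiff] at hx h1 ⊢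
  tauto

theorem isMatchingCut_of_split (hA : IsSide G U A) (hPU : P ⊆ U) (hP : P.Nonempty)
    (h : IsSplit G W (P ∪ (U ∪ A)ᶜ) (A \ W)) : IsMatchingCut G U A P W := by
  refine ⟨hA, hPU, hP, h.kcut, ?_, ?_, h.right_nonempty, h.separates⟩
  · rintro x ⟨hxU, hxP⟩
    by_contra hxW
    have := h.cover x hxW
    have h2 := hA.disjoint x
    simp only [Set.mem_union, Set.mem_compl_iff, Set.mem_sdiff] at this
    tauto
  · intro x hx
    by_contra hxU
    exact h.left_disjoint x (Or.inr hxU) hx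

theorem IsMatchingCut.inter_eq (h : IsMatchingCut G U A P W) :
    W ∩ U = U \ P := by
  ext x
  have h1 := (h.split).left_disjoint x
  have h2 : x ∈ U \ P → x ∈ W := fun hx => h.2.2.2.2.1 hx
  have h3 := fun hx : x ∈ P => h.2.1 hx
  simp only [Set.mem_union, Set.mem_inter_iff, Set.mem_sdiff] at *
  tauto

theorem IsMatchingCut.isLaminarIn (h : IsMatchingCut G U A P W) :
    IsLaminarIn G U A W := by
  have hs := h.split
  obtain ⟨hA, hPU, ⟨p, hp⟩, hW, hUW, hWU, hne, hsep⟩ := h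
  refine ⟨hA, hW, ?_, hWU⟩
  rintro rfl
  exact hs.left_disjoint p (Or.inl hp) (hPU hp)

/-- A minimum cut consists of the outer neighbors of either part of its split, and `P` fixes one
part. -/
theorem IsMatchingCut.unique [Finite V] (h : IsMatchingCut G U A P W)
    (h' : IsMatchingCut G U A P X) : W = X := by
  have hs := h.split
  have hs' := h'.split
  refine hs.kcut.eq_of_subset hs'.kcut fun w hw => ?_
  exact (hs.cut_subset hs' subset_rfl hw).resolve_right fun hh => hs.left_disjoint w hh hw

/-- Uncrossing applies: the outer parts share the other sides of `U`, and the inner parts meet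
because two cuts of size `κ` cannot cover `A`. -/
theorem IsMatchingCut.union [Finite V] (hU : IsKCut G U) (hAcard : 2 * kappa G < A.ncard)
    {P' W' : Set V} (h : IsMatchingCut G U A P W) (h' : IsMatchingCut G U A P' W') :
    ∃ Y, IsMatchingCut G U A (P ∪ P') Y := by
  have hs := h.split
  have hs' := h'.split
  have hA := h.1
  have hB : (U ∪ A)ᶜ.Nonempty := (hU.split_of_side hA).right_nonempty
  have hne : ((A \ W) ∩ (A \ W')).Nonempty := by
    by_contra hcon
    have hsub : A ⊆ W ∪ W' := by
      intro a ha
      by_contra haW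
      exact hcon ⟨a, ⟨ha, fun hh => haW (Or.inl hh)⟩, ⟨ha, fun hh => haW (Or.inr hh)⟩⟩
    have h1 := Set.ncard_le_ncard hsub
    have h2 := Set.ncard_union_le W W'
    have h3 := hs.kcut.2
    have h4 := hs'.kcut.2
    omega
  have key := (hs.symm.uncross hs'.symm hne
    (hB.mono fun x hx => ⟨Or.inr hx, Or.inr hx⟩)).symm
  refine ⟨corner W (A \ W) W' (A \ W'), isMatchingCut_of_split hA (Set.union_subset h.2.1 h'.2.1)
    (h.2.2.1.mono Set.subset_union_left) ?_⟩
  have e1 : P ∪ (U ∪ A)ᶜ ∪ (P' ∪ (U ∪ A)ᶜ) = P ∪ P' ∪ (U ∪ A)ᶜ := by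
    ext x
    simp only [Set.mem_union]
    tauto
  have e2 : A \ W ∩ (A \ W') = A \ corner W (A \ W) W' (A \ W') := by
    ext x
    simp only [corner, Set.mem_union, Set.mem_inter_iff, Set.mem_sdiff]
    tauto
  rwa [e1, e2] at key

theorem sUnion_thetaStar : ⋃₀ ThetaStar G U A = ⋃₀ Theta G U A := by
  ext x
  constructor
  · rintro ⟨R, ⟨u, -, ⟨P, hP, huP⟩, rfl⟩, hx⟩
    exact ⟨P, hP, hx P ⟨hP, huP⟩⟩
  · rintro ⟨P, hP, hx⟩
    have hPU : P ⊆ U := hP.choose_spec.2.1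
    exact ⟨_, ⟨x, hPU hx, ⟨P, hP, hx⟩, rfl⟩, fun R hR => hR.2⟩

/-- In a finite nonempty family closed under union, a maximal member is the union of the family. -/
theorem exists_isMatchingCut_sUnion [Finite V] (hU : IsKCut G U)
    (hAcard : 2 * kappa G < A.ncard) (h : ∃ P W : Set V, IsMatchingCut G U A P W) :
    ∃ X, IsMatchingCut G U A (⋃₀ ThetaStar G U A) X := by
  obtain ⟨P₀, hP₀⟩ := h
  obtain ⟨P, hP, hmax⟩ := (Set.toFinite (Theta G U A)).exists_maximal ⟨P₀, hP₀⟩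
  obtain ⟨X, hX⟩ := hP
  have he : ⋃₀ ThetaStar G U A = P := by
    rw [sUnion_thetaStar]
    refine Set.Subset.antisymm (Set.sUnion_subset fun P' hP' => ?_)
      (Set.subset_sUnion_of_mem ⟨X, hX⟩)
    obtain ⟨X', hX'⟩ := hP'
    exact Set.subset_union_right.trans
      (hmax (hX.union hU hAcard hX') (Set.subset_union_left : P ⊆ P ∪ P'))
  exact ⟨X, he ▸ hX⟩

/-! ### Laminar cuts -/

theorem IsOuterSide.region_eq [Finite V] (hU : IsKCut G U) (hW : IsLaminarIn G U A W)
    (hS : IsOuterSide G U A W S) : region G U A W = (W ∪ S)ᶜ := by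
  ext x
  constructor
  · rintro ⟨D, ⟨hD, hDS⟩, hx⟩ (h | h)
    · exact hD.disjoint x hx h
    · exact hDS (hD.eq_of_inter hS.1 ⟨x, hx, h⟩ ▸ hS)
  · intro hx
    obtain ⟨D, hD, hxD⟩ := exists_side (G := G) (U := W) fun h => hx (Or.inl h)
    refine ⟨D, ⟨hD, fun hDo => hx (Or.inr ?_)⟩, hxD⟩
    exact (existsUnique_outerSide hU hW).unique hDo hS ▸ hxD

/-- The outer side and the region of a laminar cut. -/
theorem IsLaminarIn.exists_split [Finite V] (hU : IsKCut G U) (hW : IsLaminarIn G U A W) :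
    ∃ S, IsSide G W S ∧ IsSplit G W S (region G U A W) ∧ U \ W ⊆ S ∧ (U ∪ A)ᶜ ⊆ S ∧
      region G U A W ⊆ A := by
  obtain ⟨S, hS, -⟩ := existsUnique_outerSide hU hW
  have he := hS.region_eq hU hW
  have hs := hW.2.1.split_of_side hS.1
  rw [← he] at hs
  have hB : (U ∪ A)ᶜ ⊆ S := by
    intro x hx
    obtain ⟨D, hD, hxD⟩ := exists_side (G := G) (U := U) fun h => hx (Or.inl h)
    exact hS.2.2 D hD (fun hDA => hx (Or.inr (hDA ▸ hxD))) hxD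
  refine ⟨S, hS.1, hs, hS.2.1, hB, fun x hx => ?_⟩
  by_contra hxA
  refine hs.symm.disjoint x hx ?_
  by_cases hxU : x ∈ U
  · exact hS.2.1 ⟨hxU, hs.right_disjoint x hx⟩
  · exact hB fun h => h.elim hxU hxA

theorem IsLaminarCut.kappa_le_ncard [Finite V] (hW : IsLaminarCut G U A W)
    (hs : IsSplit G W S D) (hS : IsSide G W S) : kappa G ≤ D.ncard := by
  by_contra hcon
  exact hW.2 ⟨S, hS, by rw [hs.compl_eq]; omega⟩

/-- An outer side avoiding `A` has no room beyond `U \ W` and the other sides of `U`, so the split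
is already that of a matching cut. -/
theorem IsLaminarIn.isMatchingCut [Finite V] (hU : IsKCut G U) (hW : IsLaminarIn G U A W)
    (hs : IsSplit G W S D) (hUS : U \ W ⊆ S) (hBS : (U ∪ A)ᶜ ⊆ S) (hSA : Disjoint S A) :
    IsMatchingCut G U A (U \ W) W := by
  obtain ⟨x, hx, hxW⟩ := hW.2.1.exists_mem_notMem hU hW.2.2.1
  refine isMatchingCut_of_split hW.1 Set.sdiff_subset ⟨x, hx, hxW⟩ ?_
  have e1 : U \ W ∪ (U ∪ A)ᶜ = S := by
    refine Set.Subset.antisymm (Set.union_subset hUS hBS) fun y hy => ?_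
    have h1 := hs.left_disjoint y hy
    have h2 := Set.disjoint_left.1 hSA hy
    simp only [Set.mem_union, Set.mem_sdiff, Set.mem_compl_iff]
    tauto
  have e2 : A \ W = D := by
    ext y
    have h1 := hs.cover y
    have h2 := hs.right_disjoint y
    have h3 := hs.disjoint y
    have h4 := @hUS y
    have h5 := @hBS y
    have h6 := fun hy : y ∈ S => Set.disjoint_left.1 hSA hy
    have h7 := hW.1.disjoint y
    simp only [Set.mem_union, Set.mem_sdiff, Set.mem_compl_iff] at *
    tauto
  rwa [e1, e2]

/-! ### Laminar cuts relative to a matching cut -/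

theorem IsMatchingCut.isSide [Finite V] (hU : IsKCut G U) (h : IsMatchingCut G U A P X) :
    IsSide G X (P ∪ (U ∪ A)ᶜ) := by
  have hs := h.split
  obtain ⟨S, hS, -, hUS, hBS, -⟩ := h.isLaminarIn.exists_split hU
  obtain ⟨b, hb⟩ : (U ∪ A)ᶜ.Nonempty := (hU.split_of_side h.1).right_nonempty
  have he : S = P ∪ (U ∪ A)ᶜ := by
    refine Set.Subset.antisymm (hs.side_subset hS (hBS hb) (Or.inr hb))
      (Set.union_subset (fun x hx => hUS ⟨h.2.1 hx, hs.left_disjoint x (Or.inl hx)⟩) hBS)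
  exact he ▸ hS

/-- A minimum cut that meets the side `Z` of `X` and its complement, and that has a part `D` of
size at least `κ` not meeting `Z`, is a crossing matching cut of `X`. -/
theorem isCrossingMatchingCut_of_meets [Finite V] {Z : Set V} (hX : IsSplit G X Z C) (hZ : IsSide G X Z)
    (hW : IsSplit G W S D) (hZW : (W ∩ Z).Nonempty) (hCW : (W ∩ C).Nonempty)
    (hDZ : Disjoint D Z) (hZS : (Z ∩ S).Nonempty) (hD : kappa G ≤ D.ncard) :
    ∃ P, IsCrossingMatchingCut G X Z P W := by
  have hmeet : ∀ {S' D' : Set V}, IsSplit G W S' D' → (S' ∩ X).Nonempty := by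
    intro S' D' h
    obtain ⟨T, hT, hTS⟩ := h.exists_side
    exact (hX.side_inter_nonempty h.kcut hZW hCW hT).mono (Set.inter_subset_inter_left _ hTS)
  -- If `W` missed a side of `X`, it would be laminar in a single side of `X` and could not meet
  -- both `Z` and `C`.
  have hsides : ∀ T, IsSide G X T → (W ∩ T).Nonempty := by
    intro T hT
    have hTs := hX.kcut.split_of_side hT
    by_contra hcon
    have hdis : Disjoint T W := by
      rw [Set.disjoint_iff_inter_eq_empty, Set.inter_comm]
      exact Set.not_nonempty_iff_eq_empty.1 hcon
    obtain ⟨z, hzW, hzZ⟩ := hZW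
    obtain ⟨c, hcW, hcC⟩ := hCW
    have hne : W ≠ X := by
      rintro rfl
      exact hX.left_disjoint z hzZ hzW
    obtain ⟨L, -, hL, -, -, hWL⟩ := exists_isLaminarIn hX.kcut hW.kcut hne hT hdis
    have h1 := (hWL hzW).resolve_left (hX.left_disjoint z hzZ)
    have h2 := (hWL hcW).resolve_left (hX.right_disjoint c hcC)
    exact hX.disjoint c (hX.side_subset hL h1 hzZ h2) hcC
  -- Otherwise `D ⊆ X`, and `|D| ≥ κ` forces `D = X`; but `S` also meets `X`.
  have hCD : (C ∩ D).Nonempty := by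
    by_contra hcon
    have hDX : D ⊆ X := by
      intro d hd
      by_contra hdX
      exact hcon ⟨d, hX.cover d hdX (Set.disjoint_left.1 hDZ hd), hd⟩
    have he : D = X := Set.eq_of_subset_of_ncard_le hDX (by rw [hX.kcut.2]; exact hD)
    obtain ⟨s, hs, hsX⟩ := hmeet hW
    exact hW.disjoint s hs (he ▸ hsX)
  have h1 := hX.uncross hW hZS hCD
  have h2 := hX.symm.uncross hW.symm hCD hZS
  -- A second side `T'` inside `C` would contain some `w ∈ W`. Replacing `C` by `T` in the corner
  -- boundary drops `w` and still gives a cut, now of size below `κ`.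
  have hC : IsSide G X C := by
    obtain ⟨a, haC, haD⟩ := hCD
    obtain ⟨T, hT, haT⟩ := exists_side (G := G) (hX.right_disjoint a haC)
    have hTC := hX.symm.side_subset hT haT haC
    suffices C ⊆ T from (Set.Subset.antisymm hTC this) ▸ hT
    intro c hcC
    by_contra hcT
    obtain ⟨T', hT', hcT'⟩ := exists_side (G := G) (hX.right_disjoint c hcC)
    have hT'C := hX.symm.side_subset hT' hcT' hcC
    obtain ⟨w, hw, hwT'⟩ := hsides T' hT'
    have hwT : w ∉ T := fun h => hcT (hT.eq_of_inter hT' ⟨w, h, hwT'⟩ ▸ hcT')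
    have hsub : corner X T W D ⊆ corner X C W D :=
      Set.union_subset_union_right _ (Set.inter_subset_inter_right _ hTC)
    obtain ⟨z, hz, hzS⟩ := hZS
    have hcut : IsCut G (corner X T W D) := by
      refine corner_isCut hT.closed hW.symm.closed ⟨haT, haD⟩ (hT.disjoint a haT)
        (hW.right_disjoint a haD) (b := z) (fun h => hX.disjoint z hz (hTC h.1)) fun h => ?_
      exact h2.right_disjoint z (Or.inl hz) (hsub h)
    have hlt : (corner X T W D).ncard < (corner X C W D).ncard := by
      refine Set.ncard_lt_ncard ⟨hsub, fun h => ?_⟩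
      have hwX := hX.right_disjoint w (hT'C hwT')
      rcases h (Or.inr ⟨hw, hT'C hwT'⟩ : w ∈ corner X C W D) with (h | h) | h
      · exact hwX h.1
      · exact hwX h.1
      · exact hwT h.2
    have h3 := kappa_le hcut
    have h4 := h2.kcut.2
    omega
  have e1 : X \ (X ∩ D) ∪ W ∩ Z = corner X Z W S := by
    ext x
    have h1 := hW.cover x
    have h2 := hW.left_disjoint x
    have h3 := hW.right_disjoint x
    have h4 := hW.disjoint x
    simp only [corner, Set.mem_union, Set.mem_inter_iff, Set.mem_sdiff]
    tauto
  have e2 : X ∩ D ∪ (X ∪ Z)ᶜ = C ∪ D := by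
    rw [hX.compl_eq]
    ext x
    have h1 := hX.cover x
    have h2 := fun h : x ∈ D => Set.disjoint_left.1 hDZ h
    simp only [Set.mem_union, Set.mem_inter_iff]
    tauto
  have e3 : Z \ corner X Z W S = Z ∩ S := by
    ext x
    have h1 := hX.left_disjoint x
    have h2 := fun h : x ∈ D => Set.disjoint_left.1 hDZ h
    have h3 := hW.cover x
    have h4 := hW.left_disjoint x
    simp only [corner, Set.mem_union, Set.mem_inter_iff, Set.mem_sdiff]
    tauto
  refine ⟨X ∩ D, hW.kcut, C, ?_, ?_, Set.inter_subset_left, ?_, hCW, ?_⟩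
  · rintro rfl
    obtain ⟨z, hz⟩ := hZ.nonempty
    exact hX.disjoint z hz hz
  · refine fun T => ⟨fun hT => ?_, ?_⟩
    · obtain ⟨t, ht⟩ := hT.nonempty
      by_cases htZ : t ∈ Z
      · exact Or.inl (hT.eq_of_inter hZ ⟨t, ht, htZ⟩)
      · exact Or.inr (hT.eq_of_inter hC ⟨t, ht, hX.cover t (hT.disjoint t ht) htZ⟩)
    · rintro (rfl | rfl) <;> assumption
  · rw [Set.inter_comm]
    exact hmeet hW.symm
  · rw [e1]
    refine isMatchingCut_of_split hZ Set.inter_subset_left ?_ ?_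
    · rw [Set.inter_comm]
      exact hmeet hW.symm
    · rw [e2, e3]
      exact h1.symm

/-- The laminar cuts of `U`, relative to a matching cut `X` of `U`. -/
theorem IsLaminarCut.trichotomy [Finite V] (hU : IsKCut G U) (hX : IsMatchingCut G U A P X)
    (hW : IsLaminarCut G U A W) :
    (∃ L : Set V, L ⊆ A \ (X \ U) ∧ IsLaminarIn G X L W) ∨
      (∃ P : Set V, IsMatchingCut G U A P W) ∨
      (∃ K P : Set V, IsCrossingMatchingCut G X K P W) := by
  have hXs := hX.split
  have hZ := hX.isSide hU
  have hA := hX.1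
  obtain ⟨S, hS, hWs, hUS, hBS, hRA⟩ := hW.1.exists_split hU
  have hB : (U ∪ A)ᶜ.Nonempty := (hU.split_of_side hA).right_nonempty
  have hRZ : Disjoint (region G U A W) (P ∪ (U ∪ A)ᶜ) := by
    refine Set.disjoint_left.2 fun x hx hxZ => ?_
    rcases hxZ with h | h
    · exact hA.disjoint x (hRA hx) (hX.2.1 h)
    · exact h (Or.inr (hRA hx))
  by_cases hZW : (W ∩ (P ∪ (U ∪ A)ᶜ)).Nonempty
  · by_cases hCW : (W ∩ (A \ X)).Nonempty
    · refine Or.inr (Or.inr ⟨_, isCrossingMatchingCut_of_meets hXs hZ hWs hZW hCW hRZ ?_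
        (hW.kappa_le_ncard hWs hS)⟩)
      exact hB.mono fun b hb => ⟨Or.inr hb, hBS hb⟩
    -- Here `W` misses every side of `X` inside `A \ X`. These are joined through `X \ W`, so `A \
    -- W` lies in one side `T` of `W`. As `A \ W` contains the region, `T` is not `S`, and `S`
    -- avoids `A`.
    · refine Or.inr (Or.inl ⟨U \ W, ?_⟩)
      obtain ⟨z, hzW, hzZ⟩ := hZW
      have hne : W ≠ X := by
        rintro rfl
        exact hXs.left_disjoint z hzZ hzW
      obtain ⟨x, hxX, hxW⟩ := hWs.kcut.exists_mem_notMem hXs.kcut hne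
      obtain ⟨T, hT, hxT⟩ := exists_side (G := G) hxW
      have hAT : A \ X ⊆ T := by
        intro a ha
        obtain ⟨L, hL, haL⟩ := exists_side (G := G) ha.2
        have hLA := hXs.symm.side_subset hL haL ha
        have hLW : Disjoint L W :=
          Set.disjoint_left.2 fun y hy hyW => hCW ⟨y, hyW, hLA hy⟩
        obtain ⟨l, hl, hadj⟩ := hXs.kcut.exists_adj hL hxX
        exact hL.subset_of_closed hLW hT.closed
          ⟨l, hl, hT.closed x hxT l (Set.disjoint_left.1 hLW hl) hadj.symm⟩ haL
      have hXT : X \ W ⊆ T := by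
        rintro y ⟨hy, hyW⟩
        obtain ⟨a, ha, hadj⟩ := hXs.symm.exists_adj hy
        exact hT.closed a (hAT ha) y hyW hadj
      have hAWT : A \ W ⊆ T := by
        rintro a ⟨ha, haW⟩
        by_cases haX : a ∈ X
        · exact hXT ⟨haX, haW⟩
        · exact hAT ⟨ha, haX⟩
      refine hW.1.isMatchingCut hU hWs hUS hBS (Set.disjoint_left.2 fun y hyS hyA => ?_)
      have hTS : T = S :=
        hT.eq_of_inter hS ⟨y, hAWT ⟨hyA, hWs.left_disjoint y hyS⟩, hyS⟩
      obtain ⟨r, hr⟩ := hWs.right_nonempty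
      exact hWs.disjoint r (hTS ▸ hAWT ⟨hRA hr, hWs.right_disjoint r hr⟩) hr
  · by_cases hne : W = X
    · exact Or.inr (Or.inl ⟨P, hne ▸ hX⟩)
    · have hdis : Disjoint (P ∪ (U ∪ A)ᶜ) W := by
        rw [Set.disjoint_iff_inter_eq_empty, Set.inter_comm]
        exact Set.not_nonempty_iff_eq_empty.1 hZW
      obtain ⟨L, hLZ, hL⟩ := exists_isLaminarIn hXs.kcut hWs.kcut hne hZ hdis
      refine Or.inl ⟨L, fun l hl => ?_, hL⟩
      have hlX := hL.1.disjoint l hl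
      have := hXs.cover l hlX fun h => hLZ (hL.1.eq_of_inter hZ ⟨l, hl, h⟩)
      exact ⟨this.1, fun h => hlX h.1⟩

/-! ### Maximal laminar cuts -/

/-- The vertices of `W` neighbor its region, so they stay in `X` or the region of `X`, and `W`
misses the outer side of `X`. -/
theorem IsLaminarCut.isLaminarIn_of_region_subset [Finite V] (hU : IsKCut G U)
    (hW : IsLaminarCut G U A W) (hX : IsLaminarCut G U A X) (hne : W ≠ X)
    (h : region G U A W ⊆ region G U A X) :
    ∃ L : Set V, L ⊆ region G U A X ∧ IsLaminarIn G X L W := by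
  obtain ⟨S, -, hWs, -⟩ := hW.1.exists_split hU
  obtain ⟨T, hT, hXs, -⟩ := hX.1.exists_split hU
  have hTW : Disjoint T W := by
    refine Set.disjoint_left.2 fun x hx hxW => ?_
    rcases hWs.symm.cut_subset hXs.symm h hxW with hxX | hxX
    · exact hXs.left_disjoint x hx hxX
    · exact hXs.disjoint x hx hxX
  obtain ⟨L, hLT, hL⟩ := exists_isLaminarIn hXs.kcut hWs.kcut hne hT hTW
  refine ⟨L, fun l hl => ?_, hL⟩
  exact hXs.cover l (hL.1.disjoint l hl) fun h => hLT (hL.1.eq_of_inter hT ⟨l, hl, h⟩)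

theorem IsLaminarCut.eq_of_region_eq [Finite V] (hU : IsKCut G U)
    (hW : IsLaminarCut G U A W) (hX : IsLaminarCut G U A X)
    (h : region G U A W = region G U A X) : W = X := by
  obtain ⟨S, -, hWs, -⟩ := hW.1.exists_split hU
  obtain ⟨T, hT, hXs, -⟩ := hX.1.exists_split hU
  refine hWs.kcut.eq_of_subset hXs.kcut fun w hw => ?_
  exact (hWs.symm.cut_subset hXs.symm h.le hw).resolve_right
    fun hh => hWs.right_disjoint w (h ▸ hh) hw

theorem IsLaminarCut.isMaximal_or [Finite V] (hU : IsKCut G U) (hW : IsLaminarCut G U A W) :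
    IsMaximalLaminarCut G U A W ∨ ∃ W' : Set V, IsMaximalLaminarCut G U A W' ∧
      ∃ L : Set V, L ⊆ region G U A W' ∧ IsLaminarIn G W' L W := by
  -- Equal regions mean equal cuts, so a region of largest size above that of `W` belongs to a
  -- maximal laminar cut.
  obtain ⟨M, ⟨hM, hWM⟩, hmax⟩ := Set.exists_max_image
    {X : Set V | IsLaminarCut G U A X ∧ region G U A W ⊆ region G U A X}
    (fun X => (region G U A X).ncard) (Set.toFinite _) ⟨W, hW, subset_rfl⟩
  have hMmax : IsMaximalLaminarCut G U A M := by
    refine ⟨hM, ?_⟩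
    rintro ⟨X, hX, hne, hsub⟩
    exact hne (hM.eq_of_region_eq hU hX
      (Set.eq_of_subset_of_ncard_le hsub (hmax X ⟨hX, hWM.trans hsub⟩))).symm
  by_cases hne : W = M
  · exact Or.inl (hne ▸ hMmax)
  · exact Or.inr ⟨M, hMmax, hW.isLaminarIn_of_region_subset hU hM hne hWM⟩

/-! ### The 4-wheel of two crossing cuts -/

/-- If `W` missed `C'`, the boundaries of `C ∩ C'` and `D ∩ C'` would be minimum cuts inside `X`,
hence both `X`. A vertex in both lies in `W`, giving `X = W`. -/
theorem IsSplit.cut_inter_nonempty [Finite V] (h : IsSplit G W C D) (h' : IsSplit G X C' D')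
    (hne : W ≠ X) (hCC : (C ∩ C').Nonempty) (hCD : (C ∩ D').Nonempty) (hDC : (D ∩ C').Nonempty)
    (hDD : (D ∩ D').Nonempty) : (W ∩ C').Nonempty := by
  by_contra hcon
  have hWC : ∀ x ∈ W, x ∉ C' := fun x hx hx' => hcon ⟨x, hx, hx'⟩
  have h1 := h.uncross h' hCC hDD
  have h2 := h.symm.uncross h' hDC hCD
  have hsub : ∀ {C : Set V}, corner W C X C' ⊆ X := by
    rintro C x ((hx | hx) | hx)
    · exact absurd hx.2 (hWC x hx.1)
    · exact hx.2
    · exact hx.1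
  have e1 := h1.kcut.eq_of_subset h'.kcut hsub
  have e2 := h2.kcut.eq_of_subset h'.kcut hsub
  refine hne (h'.kcut.eq_of_subset h.kcut fun x hx => ?_).symm
  have m1 := e1.symm ▸ hx
  have m2 := e2.symm ▸ hx
  rcases m1 with (m | m) | m
  · exact m.1
  · exact m.1
  · rcases m2 with (m' | m') | m'
    · exact m'.1
    · exact m'.1
    · exact absurd m'.2 (h.disjoint x m.2)

theorem part_eq {x : V}
    (h : (x ∈ W → x ∉ C ∧ x ∉ D) ∧ (x ∈ C → x ∉ D) ∧ (x ∈ W ∨ x ∈ C ∨ x ∈ D)) :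
    (x ∈ W ∨ x ∈ C ∨ x ∈ D) ∧
      ∀ i j : Fin 3, x ∈ (![W, C, D] : Fin 3 → Set V) i →
        x ∈ (![W, C, D] : Fin 3 → Set V) j → i = j := by
  refine ⟨h.2.2, fun i j hi hj => ?_⟩
  fin_cases i <;> fin_cases j <;> simp at hi hj ⊢ <;> tauto

theorem forall_zmod_four {p : ZMod 4 → Prop} (h0 : p 0) (h1 : p 1) (h2 : p 2) (h3 : p 3) :
    ∀ i, p i := by
  intro i
  fin_cases i <;> assumption

/-- Two crossing minimum cuts, all of whose corners are nonempty, form a 4-wheel. -/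
theorem isWheelCut_corner [Finite V] (h : IsSplit G W C D) (h' : IsSplit G X C' D')
    (hne : W ≠ X) (hCC : (C ∩ C').Nonempty) (hCD : (C ∩ D').Nonempty) (hDC : (D ∩ C').Nonempty)
    (hDD : (D ∩ D').Nonempty) : IsWheelCut G (corner W C X C') := by
  have hW : ∀ x, (x ∈ W → x ∉ C ∧ x ∉ D) ∧ (x ∈ C → x ∉ D) ∧ (x ∈ W ∨ x ∈ C ∨ x ∈ D) := by
    intro x
    have h1 := h.left_disjoint x
    have h2 := h.right_disjoint x
    have h3 := h.disjoint x
    have h4 := h.cover x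
    tauto
  have hX : ∀ x, (x ∈ X → x ∉ C' ∧ x ∉ D') ∧ (x ∈ C' → x ∉ D') ∧
      (x ∈ X ∨ x ∈ C' ∨ x ∈ D') := by
    intro x
    have h1 := h'.left_disjoint x
    have h2 := h'.right_disjoint x
    have h3 := h'.disjoint x
    have h4 := h'.cover x
    tauto
  -- The two splits cut `V` into a 3 × 3 grid with index 0 for the cut itself. The cell (0, 0) is
  -- the center; `f` lists the spokes and `g` the sectors in cyclic order.
  let a : Fin 3 → Set V := ![W, C, D]
  let b : Fin 3 → Set V := ![X, C', D']
  let cell : Fin 3 × Fin 3 → Set V := fun p => a p.1 ∩ b p.2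
  let f : ZMod 4 → Fin 3 × Fin 3 := ![(0, 2), (1, 0), (0, 1), (2, 0)]
  let g : ZMod 4 → Fin 3 × Fin 3 := ![(1, 2), (1, 1), (2, 1), (2, 2)]
  have ha : ∀ x, (x ∈ a 0 ∨ x ∈ a 1 ∨ x ∈ a 2) ∧ ∀ i j, x ∈ a i → x ∈ a j → i = j :=
    fun x => part_eq (hW x)
  have hb : ∀ x, (x ∈ b 0 ∨ x ∈ b 1 ∨ x ∈ b 2) ∧ ∀ i j, x ∈ b i → x ∈ b j → i = j :=
    fun x => part_eq (hX x)
  have key : ∀ p q, p ≠ q → Disjoint (cell p) (cell q) := fun p q hpq =>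
    Set.disjoint_left.2 fun x hp hq =>
      hpq (Prod.ext ((ha x).2 _ _ hp.1 hq.1) ((hb x).2 _ _ hp.2 hq.2))
  have eW : W ∩ C' ∪ W ∩ X ∪ W ∩ D' = W := by
    ext x
    have := hX x
    simp only [Set.mem_union, Set.mem_inter_iff]
    tauto
  have eX : C ∩ X ∪ W ∩ X ∪ D ∩ X = X := by
    ext x
    have := hW x
    simp only [Set.mem_union, Set.mem_inter_iff]
    tauto
  have eW' : W ∩ D' ∪ W ∩ X ∪ W ∩ C' = W := by
    rw [Set.union_right_comm, Set.union_comm (W ∩ D'), Set.union_right_comm, eW]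
  have eX' : D ∩ X ∪ W ∩ X ∪ C ∩ X = X := by
    rw [Set.union_right_comm, Set.union_comm (D ∩ X), Set.union_right_comm, eX]
  have sep : ∀ {W C D E F : Set V}, IsSplit G W C D → E = W → F = C →
      Separates G E F (E ∪ F)ᶜ := by
    rintro W C D _ _ h rfl rfl
    rw [h.compl_eq]
    exact h.separates
  refine ⟨4, W ∩ X, fun i => cell (f i), fun i => cell (g i), 2, 1,
    ⟨le_rfl, ?_, ?_, fun i j hij => key _ _ ?_, fun i j hij => key _ _ ?_,
    fun i j => key _ _ ?_, fun i => key (0, 0) _ ?_, fun i => key (0, 0) _ ?_, ?_, ?_, ?_⟩,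
    by decide, ?_⟩
  · refine forall_zmod_four (h.cut_inter_nonempty h'.symm hne hCD hCC hDD hDC) ?_
      (h.cut_inter_nonempty h' hne hCC hCD hDC hDD) ?_
    · change (C ∩ X).Nonempty
      exact Set.inter_comm X C ▸ h'.cut_inter_nonempty h hne.symm (by rwa [Set.inter_comm])
        (by rwa [Set.inter_comm]) (by rwa [Set.inter_comm]) (by rwa [Set.inter_comm])
    · change (D ∩ X).Nonempty
      exact Set.inter_comm X D ▸ h'.cut_inter_nonempty h.symm hne.symm (by rwa [Set.inter_comm])
        (by rwa [Set.inter_comm]) (by rwa [Set.inter_comm]) (by rwa [Set.inter_comm])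
  · exact forall_zmod_four hCD hCC hDC hDD
  · exact fun he => hij ((by decide : Function.Injective
      (![(0, 2), (1, 0), (0, 1), (2, 0)] : Fin 4 → Fin 3 × Fin 3)) he)
  · exact fun he => hij ((by decide : Function.Injective
      (![(1, 2), (1, 1), (2, 1), (2, 2)] : Fin 4 → Fin 3 × Fin 3)) he)
  · exact (by decide : ∀ i j : Fin 4, (![(0, 2), (1, 0), (0, 1), (2, 0)] : Fin 4 → Fin 3 × Fin 3) i ≠
      (![(1, 2), (1, 1), (2, 1), (2, 2)] : Fin 4 → Fin 3 × Fin 3) j) i j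
  · exact (by decide : ∀ i : Fin 4,
      (0, 0) ≠ (![(0, 2), (1, 0), (0, 1), (2, 0)] : Fin 4 → Fin 3 × Fin 3) i) i
  · exact (by decide : ∀ i : Fin 4,
      (0, 0) ≠ (![(1, 2), (1, 1), (2, 1), (2, 2)] : Fin 4 → Fin 3 × Fin 3) i) i
  · refine Set.eq_univ_of_forall fun x => ?_
    simp only [Set.mem_union, Set.mem_iUnion]
    have m0 : ∀ i, x ∈ cell (f i) →
        (x ∈ W ∩ X ∨ ∃ i, x ∈ cell (f i)) ∨ ∃ i, x ∈ cell (g i) :=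
      fun i hi => Or.inl (Or.inr ⟨i, hi⟩)
    have m1 : ∀ i, x ∈ cell (g i) →
        (x ∈ W ∩ X ∨ ∃ i, x ∈ cell (f i)) ∨ ∃ i, x ∈ cell (g i) :=
      fun i hi => Or.inr ⟨i, hi⟩
    rcases (ha x).1 with a | a | a <;> rcases (hb x).1 with b | b | b
    · exact Or.inl (Or.inl ⟨a, b⟩)
    · exact m0 2 ⟨a, b⟩
    · exact m0 0 ⟨a, b⟩
    · exact m0 1 ⟨a, b⟩
    · exact m1 1 ⟨a, b⟩
    · exact m1 0 ⟨a, b⟩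
    · exact m0 3 ⟨a, b⟩
    · exact m1 2 ⟨a, b⟩
    · exact m1 3 ⟨a, b⟩
  · exact forall_zmod_four (eW'.symm ▸ h.kcut) (eX.symm ▸ h'.kcut) (eW.symm ▸ h.kcut)
      (eX'.symm ▸ h'.kcut)
  · have part : ∀ {W X C D C' D' : Set V}, IsSplit G W C D → IsSplit G X C' D' →
        C ∩ D' ∪ C ∩ X ∪ C ∩ C' = C := by
      intro W X C D C' D' _ h'
      ext x
      have := h'.cover x
      simp only [Set.mem_union, Set.mem_inter_iff]
      tauto
    refine forall_zmod_four ?_ ?_ ?_ ?_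
    · exact sep h eW' (part h h')
    · refine sep h' eX ?_
      have := part h' h.symm
      rwa [Set.inter_comm C' C, Set.inter_comm C' W, Set.inter_comm C' D] at this
    · exact sep h.symm eW (part h.symm h'.symm)
    · refine sep h'.symm eX' ?_
      have := part h'.symm h
      rwa [Set.inter_comm D' C, Set.inter_comm D' W, Set.inter_comm D' D] at this
  · change W ∩ C' ∪ W ∩ X ∪ X ∩ C = W ∩ C' ∪ W ∩ X ∪ C ∩ X
    rw [Set.inter_comm X C]

/-! ### Disjoint regions of maximal laminar cuts -/

theorem IsMaximalLaminarCut.disjoint [Finite V] (hU : IsKCut G U)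
    (hUsmall : ¬ IsSmallI G U (kappa G - 1)) (hUwheel : ¬ IsWheelCut G U)
    (hmat : ¬ ∃ P W : Set V, IsMatchingCut G U A P W)
    (hW : IsMaximalLaminarCut G U A W) (hX : IsMaximalLaminarCut G U A X) (hne : W ≠ X) :
    Disjoint (region G U A W) (region G U A X) := by
  obtain ⟨S, hS, hWs, hUS, hBS, hRA⟩ := hW.1.1.exists_split hU
  obtain ⟨T, hT, hXs, hUT, hBT, hRA'⟩ := hX.1.1.exists_split hU
  have hA := hW.1.1.1
  have hAs := hU.split_of_side hA
  obtain ⟨b, hb⟩ := hAs.right_nonempty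
  by_contra hcon
  have hRR := Set.not_disjoint_iff_nonempty_inter.1 hcon
  have hun := hWs.uncross hXs ⟨b, hBS hb, hBT hb⟩ hRR
  by_cases he : corner W S X T = U
  -- Without matching cuts each outer side meets `A`. Since `A` is covered by the two regions, each
  -- outer side meets the other cut's region.
  · have hmeet : ∀ {W S : Set V}, IsLaminarCut G U A W → IsSplit G W S (region G U A W) →
        U \ W ⊆ S → (U ∪ A)ᶜ ⊆ S → (S ∩ A).Nonempty := by
      intro W S hW hWs hUS hBS
      by_contra hcon
      exact hmat ⟨_, _, hW.1.isMatchingCut hU hWs hUS hBS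
        (Set.disjoint_iff_inter_eq_empty.2 (Set.not_nonempty_iff_eq_empty.1 hcon))⟩
    rw [he] at hun
    have hAR : A ⊆ region G U A W ∪ region G U A X := by
      obtain ⟨r, hr, -⟩ := hRR
      exact hun.symm.side_subset hA (hRA hr) (Or.inl hr)
    refine hUwheel (he ▸ isWheelCut_corner hWs hXs hne ⟨b, hBS hb, hBT hb⟩ ?_ ?_ hRR)
    · obtain ⟨s, hs, hsA⟩ := hmeet hW.1 hWs hUS hBS
      exact ⟨s, hs, (hAR hsA).resolve_left (hWs.disjoint s hs)⟩
    · obtain ⟨t, ht, htA⟩ := hmeet hX.1 hXs hUT hBT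
      exact ⟨t, (hAR htA).resolve_right (hXs.disjoint t ht), ht⟩
  · have hlam : IsLaminarIn G U A (corner W S X T) := by
      refine ⟨hA, hun.kcut, he, ?_⟩
      rintro x ((h | h) | h)
      · exact hW.1.1.2.2.2 h.1
      · exact hW.1.1.2.2.2 h.1
      · exact hX.1.1.2.2.2 h.1
    obtain ⟨Y, hY, hYs, hUY, hBY, -⟩ := hlam.exists_split hU
    have hYsub := hun.side_subset hY (hBY hb) ⟨hBS hb, hBT hb⟩
    have hsub : region G U A W ∪ region G U A X ⊆ region G U A (corner W S X T) := fun x hx =>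
      hYs.cover x (hun.right_disjoint x hx) fun h => hun.disjoint x (hYsub h) hx
    have hBcard : kappa G ≤ ((U ∪ A)ᶜ).ncard := by
      by_contra hlt
      exact hUsmall ⟨A, hA, by omega⟩
    have hlc : IsLaminarCut G U A (corner W S X T) := by
      refine ⟨hlam, ?_⟩
      rintro ⟨L, hL, hcard⟩
      have hWR := hW.1.kappa_le_ncard hWs hS
      -- The complement contains `R(W)` or all sides of `U` other than `A`, each of size at least
      -- `κ`. Positivity is needed for `κ = 0`, where `κ - 1` truncates to 0.
      have hle : kappa G ≤ ((corner W S X T ∪ L)ᶜ).ncard ∧ 0 < ((corner W S X T ∪ L)ᶜ).ncard := by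
        by_cases hLY : L = Y
        · rw [hLY, hYs.compl_eq]
          exact ⟨hWR.trans (Set.ncard_le_ncard (Set.subset_union_left.trans hsub)),
            (Set.ncard_pos).2 hYs.right_nonempty⟩
        · have hBL : (U ∪ A)ᶜ ⊆ (corner W S X T ∪ L)ᶜ := by
            rintro x hx (h | h)
            · exact hYs.left_disjoint x (hBY hx) h
            · exact hLY (hL.eq_of_inter hY ⟨x, h, hBY hx⟩)
          exact ⟨hBcard.trans (Set.ncard_le_ncard hBL), (Set.ncard_pos).2 ⟨b, hBL hb⟩⟩
      omega
    have h1 : corner W S X T = W := by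
      by_contra h
      exact hW.2 ⟨_, hlc, h, Set.subset_union_left.trans hsub⟩
    have h2 : corner W S X T = X := by
      by_contra h
      exact hX.2 ⟨_, hlc, h, Set.subset_union_right.trans hsub⟩
    exact hne (h1.symm.trans h2)

end VertexCuts

open VertexCuts
theorem mainTheorem4 {V : Type*} [Finite V] (G : SimpleGraph V) (hG : G.Connected)
    (hn : 4 * kappa G < Nat.card V)
    (U A : Set V) (hU : IsKCut G U)
    (hUsmall : ¬ IsSmallI G U (kappa G - 1))
    (hUwheel : ¬ IsWheelCut G U)
    (hA : IsSide G U A) (hAcard : 2 * kappa G < A.ncard) :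
    ((∃ P W : Set V, IsMatchingCut G U A P W) →
      ∃ X : Set V, IsMatchingCut G U A (⋃₀ ThetaStar G U A) X ∧
        (∀ P Y : Set V, IsMatchingCut G U A P Y → Y ≠ X → X ∩ U ⊂ Y ∩ U) ∧
        ∀ W : Set V, IsLaminarCut G U A W →
          (∃ L : Set V, L ⊆ A \ (X \ U) ∧ IsLaminarIn G X L W) ∨
          (∃ P : Set V, IsMatchingCut G U A P W) ∨
          (∃ K P : Set V, IsCrossingMatchingCut G X K P W)) ∧
    ((¬ ∃ P W : Set V, IsMatchingCut G U A P W) →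
      (∀ W : Set V, IsLaminarCut G U A W →
        IsMaximalLaminarCut G U A W ∨
        ∃ W' : Set V, IsMaximalLaminarCut G U A W' ∧
          ∃ L : Set V, L ⊆ region G U A W' ∧ IsLaminarIn G W' L W) ∧
      ∀ W₁ W₂ : Set V, IsMaximalLaminarCut G U A W₁ → IsMaximalLaminarCut G U A W₂ →
        W₁ ≠ W₂ → Disjoint (region G U A W₁) (region G U A W₂)) := by
  refine ⟨fun hmat => ?_, fun hmat => ⟨fun W hW => hW.isMaximal_or hU, fun W₁ W₂ h₁ h₂ hne =>
    h₁.disjoint hU hUsmall hUwheel hmat h₂ hne⟩⟩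
  obtain ⟨X, hX⟩ := exists_isMatchingCut_sUnion hU hAcard hmat
  refine ⟨X, hX, fun P Y hY hne => ?_, fun W hW => hW.trichotomy hU hX⟩
  have hPQ : P ⊆ ⋃₀ ThetaStar G U A := by
    rw [sUnion_thetaStar]
    exact Set.subset_sUnion_of_mem ⟨Y, hY⟩
  rw [hX.inter_eq, hY.inter_eq]
  refine ⟨Set.sdiff_subset_sdiff_right hPQ, fun hsub => hne ?_⟩
  have he : P = ⋃₀ ThetaStar G U A := by
    refine Set.Subset.antisymm hPQ fun x hx => ?_
    by_contra hxP
    exact (hsub ⟨hX.2.1 hx, hxP⟩).2 hx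
  exact (he ▸ hY).unique hX
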